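/- For a complex number $z$ and an integer $k\ge 0$ let $(z)_k=z(z+1)\cdots(z+k-1)$ be the Pochhammer symbol, with $(z)_0=1$. Let $n,K\ge 0$ be integers, let $\alpha,x_1,\dots,x_n,y_1,\dots,y_n$ be complex numbers, and let all sums below run over all $n$-tuples $\mathbf k=(k_1,\dots,k_n)$ of non-negative integers with $|\mathbf k|=k_1+\dots+k_n=K$. If none of the denominators occurring below vanishes, then $$\sum_{|\mathbf k|=K}\ \prod_{i=1}^n\frac{(1+\alpha)_{k_i}}{k_i!}\ \prod_{\substack{i,j=1\\ i\ne j}}^n\frac{(x_i-x_j-k_j-\alpha)_{k_i}}{(x_i-x_j-k_j)_{k_i}}\ \prod_{a,j=1}^n\frac{(x_j-y_a+\alpha)_{k_j}}{(x_j-y_a)_{k_j}}$$ $$=\ \sum_{|\mathbf k|=K}\ \prod_{a=1}^n\frac{(1+\alpha)_{k_a}}{k_a!}\ \prod_{\substack{a,b=1\\ a\ne b}}^n\frac{(y_a-y_b-k_a-\alpha)_{k_b}}{(y_a-y_b-k_a)_{k_b}}\ \prod_{j,a=1}^n\frac{(x_j-y_a+\alpha)_{k_a}}{(x_j-y_a)_{k_a}}.$$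 -/

import Mathlib

/-- The Pochhammer symbol `(z)_k = z (z + 1) ⋯ (z + k - 1)` of a complex number. -/
noncomputable abbrev poch (z : ℂ) (k : ℕ) : ℂ := (ascPochhammer ℂ k).eval z

/-- Check of the convention: `(z)_k = ∏_{0 ≤ m < k} (z + m)`. -/
theorem poch_eq_prod (z : ℂ) (k : ℕ) : poch z k = ∏ m ∈ Finset.range k, (z + m) := by
  induction k with
  | zero => simp [poch]
  | succ k ih => rw [Finset.prod_range_succ, ← ih, poch, ascPochhammer_succ_eval]

/-- The `n`-tuples `(k_1, …, k_n)` of non-negative integers with `k_1 + ⋯ + k_n = K`. -/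
abbrev tuples (n K : ℕ) : Finset (Fin n → ℕ) := Finset.piAntidiag Finset.univ K

/-- Check of the convention. -/
theorem mem_tuples (n K : ℕ) (k : Fin n → ℕ) : k ∈ tuples n K ↔ ∑ i, k i = K := by
  simp [tuples, Finset.mem_piAntidiag]

/-! The duality is a specialisation of a symmetric identity for subsets. With the weight `w(u) = (u
- a)(u + a - c) / (u(u - c))`, the sum over all `I` of fixed size of `∏ w(z_i - z_j)`, `i ∈ I`, `j ∉
I`, does not change under `z ↦ -z` (`cutSum_sourceWeight_comm`). This goes by induction on the
number of points: one point becomes a variable, denominators are cleared, and the difference of the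
two sides is a polynomial with more roots than its degree allows.

Now take `a = 1`, `c = 1 + α` and let the points form strings `x_j, x_j + 1, …, x_j + m_j - 1`.
Since `w(1) = 0`, only initial segments of lengths `k_j` survive, and telescoping turns the sum into
the left-hand side with `y_j = x_j + m_j + α` (`cutSum_strings`). Negation maps strings to strings,
which gives the right-hand side (`dualitySum_eq_of_isGenericFor`).

Both sides are rational in `α`, `x` and `y - x - α`, so validity for infinitely many integers `m_j`
and enough generic `α`, `x` yields the general case (`IsRationalOn.eq_of_eqOn_pi`). -/

open Finset Polynomial

/-! ### Cut sums over subsets, and their dependence on one distinguished point -/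

section CutSums

variable {ι : Type*} [DecidableEq ι]

/-- The product of the pair weights `f i j` over all pairs with `i ∈ I` and `j ∈ s \ I`. -/
noncomputable def cutWeight (f : ι → ι → ℂ) (s I : Finset ι) : ℂ :=
  ∏ i ∈ I, ∏ j ∈ s \ I, f i j

/-- The sum of the cut weights over all subsets `I` of `s`, weighted by a function of `#I`. -/
noncomputable def cutSum (g : ℕ → ℂ) (f : ι → ι → ℂ) (s : Finset ι) : ℂ :=
  ∑ I ∈ s.powerset, g #I * cutWeight f s I

/-- The cut sum over `insert p t` after clearing the denominators `Q j` of the weights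
`f p j = A j / Q j` and `f j p = B j / Q j`. -/
noncomputable def clearedCutSum {R : Type*} [CommRing R] [Algebra ℂ R] (g : ℕ → ℂ)
    (f : ι → ι → ℂ) (t : Finset ι) (A B Q : ι → R) : R :=
  ∑ I ∈ t.powerset,
    ((g #I * cutWeight f t I) • ((∏ i ∈ I, B i) * ∏ j ∈ t \ I, Q j) +
      (g (#I + 1) * cutWeight f t I) • ((∏ i ∈ I, Q i) * ∏ j ∈ t \ I, A j))

theorem cutWeight_insert_left (f : ι → ι → ℂ) {p : ι} {t I : Finset ι} (hp : p ∉ t)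
    (hI : I ⊆ t) :
    cutWeight f (insert p t) (insert p I) = cutWeight f t I * ∏ j ∈ t \ I, f p j := by
  have h : insert p t \ insert p I = t \ I := by
    ext j; simp only [mem_sdiff, mem_insert]
    constructor
    · rintro ⟨h1, h2⟩; tauto
    · rintro ⟨h1, h2⟩; refine ⟨.inr h1, ?_⟩; rintro (rfl | h3) <;> tauto
  rw [cutWeight, h, prod_insert (fun h => hp (hI h)), mul_comm]; rfl

theorem cutWeight_insert_right (f : ι → ι → ℂ) {p : ι} {t I : Finset ι} (hp : p ∉ t)
    (hI : I ⊆ t) :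
    cutWeight f (insert p t) I = cutWeight f t I * ∏ i ∈ I, f i p := by
  have hpI : p ∉ I := fun h => hp (hI h)
  rw [cutWeight, cutWeight, ← prod_mul_distrib, insert_sdiff_of_notMem _ hpI]
  refine prod_congr rfl fun i _ => ?_
  rw [prod_insert (by simp [hp]), mul_comm]

theorem clearedCutSum_eq (g : ℕ → ℂ) (f : ι → ι → ℂ) {p : ι} {t : Finset ι} (hp : p ∉ t)
    (A B Q : ι → ℂ) (hA : ∀ j ∈ t, A j = f p j * Q j) (hB : ∀ j ∈ t, B j = f j p * Q j) :
    clearedCutSum g f t A B Q = (∏ j ∈ t, Q j) * cutSum g f (insert p t) := by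
  rw [cutSum, sum_powerset_insert hp, ← sum_add_distrib, mul_sum, clearedCutSum]
  refine sum_congr rfl fun I hI => ?_
  have hI := mem_powerset.1 hI
  rw [card_insert_of_notMem (fun h => hp (hI h)), cutWeight_insert_left f hp hI,
    cutWeight_insert_right f hp hI, ← prod_sdiff hI, smul_eq_mul, smul_eq_mul,
    prod_congr rfl fun i hi => hB i (hI hi),
    prod_congr rfl fun i hi => hA i (mem_sdiff.1 hi).1, prod_mul_distrib, prod_mul_distrib]
  ring

/-- When `Q q = 0`, only those subsets survive that separate `q` from the distinguished point. They
contain exactly one of the two, hence the common factor `g (#I + 1)`. -/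
theorem clearedCutSum_insert (g : ℕ → ℂ) (f : ι → ι → ℂ) {q : ι} {r : Finset ι} (hq : q ∉ r)
    (A B Q : ι → ℂ) (hQ : Q q = 0) :
    clearedCutSum g f (insert q r) A B Q = ∑ I ∈ r.powerset, g (#I + 1) * cutWeight f r I *
      (B q * (∏ j ∈ r \ I, f q j) * (∏ i ∈ I, B i) * (∏ j ∈ r \ I, Q j) +
        A q * (∏ i ∈ I, f i q) * (∏ i ∈ I, Q i) * (∏ j ∈ r \ I, A j)) := by
  rw [clearedCutSum, sum_powerset_insert hq, ← sum_add_distrib]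
  refine sum_congr rfl fun I hI => ?_
  have hI := mem_powerset.1 hI
  have hqI : q ∉ I := fun h => hq (hI h)
  have h : insert q r \ insert q I = r \ I := by
    ext j; simp only [mem_sdiff, mem_insert]
    constructor
    · rintro ⟨h1, h2⟩; tauto
    · rintro ⟨h1, h2⟩; refine ⟨.inr h1, ?_⟩; rintro (rfl | h3) <;> tauto
  rw [h, insert_sdiff_of_notMem _ hqI, card_insert_of_notMem hqI,
    cutWeight_insert_left f hq hI, cutWeight_insert_right f hq hI,
    prod_insert hqI, prod_insert hqI, prod_insert (by simp [hq]), prod_insert (by simp [hq]), hQ]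
  simp only [smul_eq_mul]
  ring

/-- The two points coincide here, so exchanging them pairs the surviving terms with opposite signs.
-/
theorem clearedCutSum_insert_eq_zero (g : ℕ → ℂ) (f : ι → ι → ℂ) {q : ι} {r : Finset ι}
    (hq : q ∉ r) (A B Q : ι → ℂ) (hQ : Q q = 0) (hAB : A q = -B q)
    (hA : ∀ j ∈ r, A j = f q j * Q j) (hB : ∀ j ∈ r, B j = f j q * Q j) :
    clearedCutSum g f (insert q r) A B Q = 0 := by
  rw [clearedCutSum_insert g f hq A B Q hQ]
  refine sum_eq_zero fun I hI => ?_
  have hI := mem_powerset.1 hI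
  rw [hAB, prod_congr rfl fun i hi => hB i (hI hi),
    prod_congr rfl fun i hi => hA i (mem_sdiff.1 hi).1, prod_mul_distrib, prod_mul_distrib]
  ring

/-- The factors for `I` and for its complement have the same form `f j q * Q j`, so their product
does not depend on `I` and a smaller cut sum remains. -/
theorem clearedCutSum_insert_of_right (g : ℕ → ℂ) (f : ι → ι → ℂ) {q : ι} {r : Finset ι}
    (hq : q ∉ r) (A B Q : ι → ℂ) (hQ : Q q = 0) (hBq : B q = 0)
    (hA : ∀ j ∈ r, A j = f j q * Q j) :
    clearedCutSum g f (insert q r) A B Q =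
      A q * (∏ j ∈ r, f j q * Q j) * cutSum (fun k => g (k + 1)) f r := by
  rw [clearedCutSum_insert g f hq A B Q hQ, cutSum, mul_sum]
  refine sum_congr rfl fun I hI => ?_
  have hI := mem_powerset.1 hI
  rw [hBq, prod_congr rfl fun i hi => hA i (mem_sdiff.1 hi).1, ← prod_sdiff hI,
    prod_mul_distrib, prod_mul_distrib]
  ring

theorem clearedCutSum_insert_of_left (g : ℕ → ℂ) (f : ι → ι → ℂ) {q : ι} {r : Finset ι}
    (hq : q ∉ r) (A B Q : ι → ℂ) (hQ : Q q = 0) (hAq : A q = 0)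
    (hB : ∀ j ∈ r, B j = f q j * Q j) :
    clearedCutSum g f (insert q r) A B Q =
      B q * (∏ j ∈ r, f q j * Q j) * cutSum (fun k => g (k + 1)) f r := by
  rw [clearedCutSum_insert g f hq A B Q hQ, cutSum, mul_sum]
  refine sum_congr rfl fun I hI => ?_
  have hI := mem_powerset.1 hI
  rw [hAq, prod_congr rfl fun i hi => hB i (hI hi), ← prod_sdiff hI,
    prod_mul_distrib, prod_mul_distrib]
  ring

theorem eval_clearedCutSum (g : ℕ → ℂ) (f : ι → ι → ℂ) (t : Finset ι) (A B Q : ι → ℂ[X])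
    (u : ℂ) :
    (clearedCutSum g f t A B Q).eval u = clearedCutSum g f t (fun j => (A j).eval u)
      (fun j => (B j).eval u) (fun j => (Q j).eval u) := by
  simp [clearedCutSum, eval_finsetSum, eval_prod]

theorem coeff_prod_mul_prod_sdiff {t I : Finset ι} (hI : I ⊆ t) {d m : ℕ} (A B : ι → ℂ[X])
    (hA : ∀ j, (A j).Monic ∧ (A j).natDegree = d) (hB : ∀ j, (B j).Monic ∧ (B j).natDegree = d)
    (hm : #t * d ≤ m) :
    ((∏ i ∈ I, A i) * ∏ j ∈ t \ I, B j).coeff m = if m = #t * d then 1 else 0 := by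
  have hmA : (∏ i ∈ I, A i).Monic := monic_prod_of_monic _ _ fun i _ => (hA i).1
  have hmB : (∏ j ∈ t \ I, B j).Monic := monic_prod_of_monic _ _ fun i _ => (hB i).1
  have hdeg : ((∏ i ∈ I, A i) * ∏ j ∈ t \ I, B j).natDegree = #t * d := by
    rw [hmA.natDegree_mul hmB, natDegree_prod_of_monic _ _ fun i _ => (hA i).1,
      natDegree_prod_of_monic _ _ fun i _ => (hB i).1, sum_congr rfl fun i _ => (hA i).2,
      sum_congr rfl fun i _ => (hB i).2, sum_const, sum_const, smul_eq_mul, smul_eq_mul,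
      ← add_mul, add_comm, card_sdiff_add_card_eq_card hI]
  split_ifs with h
  · rw [h, ← hdeg]; exact (hmA.mul hmB).coeff_natDegree
  · exact coeff_eq_zero_of_natDegree_lt (by omega)

/-- Every product is monic of degree `#t * d`; the two cut sums come from the distinguished point
lying outside or inside the subset. -/
theorem coeff_clearedCutSum (g : ℕ → ℂ) (f : ι → ι → ℂ) (t : Finset ι) {d m : ℕ}
    (A B Q : ι → ℂ[X])
    (hA : ∀ j, (A j).Monic ∧ (A j).natDegree = d) (hB : ∀ j, (B j).Monic ∧ (B j).natDegree = d)
    (hQ : ∀ j, (Q j).Monic ∧ (Q j).natDegree = d) (hm : #t * d ≤ m) :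
    (clearedCutSum g f t A B Q).coeff m =
      if m = #t * d then cutSum g f t + cutSum (fun k => g (k + 1)) f t else 0 := by
  have h : ∀ I ∈ t.powerset,
      ((g #I * cutWeight f t I) • ((∏ i ∈ I, B i) * ∏ j ∈ t \ I, Q j) +
        (g (#I + 1) * cutWeight f t I) • ((∏ i ∈ I, Q i) * ∏ j ∈ t \ I, A j)).coeff m =
      if m = #t * d then g #I * cutWeight f t I + g (#I + 1) * cutWeight f t I else 0 := by
    intro I hI
    have hI := mem_powerset.1 hI
    rw [coeff_add, coeff_smul, coeff_smul, coeff_prod_mul_prod_sdiff hI B Q hB hQ hm,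
      coeff_prod_mul_prod_sdiff hI Q A hQ hA hm]
    split_ifs <;> simp
  rw [clearedCutSum, finsetSum_coeff, sum_congr rfl h]
  split_ifs
  · rw [sum_add_distrib]; rfl
  · simp

end CutSums

/-! ### The rational source identity, by interpolation -/

section SourceIdentity

variable {ι : Type*} [DecidableEq ι]

/-- The pair weight of the rational source identity. -/
noncomputable def sourceWeight (a c u : ℂ) : ℂ := (u - a) * (u + a - c) / (u * (u - c))

/-- Monic cubic polynomial with roots `r`, `s` and `t`. -/
noncomputable def cubicOfRoots (r s t : ℂ) : ℂ[X] := (X - C r) * (X - C s) * (X - C t)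

theorem monic_cubicOfRoots (r s t : ℂ) :
    (cubicOfRoots r s t).Monic ∧ (cubicOfRoots r s t).natDegree = 3 := by
  have h := ((monic_X_sub_C r).mul (monic_X_sub_C s)).mul (monic_X_sub_C t)
  refine ⟨h, ?_⟩
  rw [cubicOfRoots, ((monic_X_sub_C r).mul (monic_X_sub_C s)).natDegree_mul (monic_X_sub_C t),
    (monic_X_sub_C r).natDegree_mul (monic_X_sub_C s)]
  simp

@[simp] theorem eval_cubicOfRoots (r s t u : ℂ) :
    (cubicOfRoots r s t).eval u = (u - r) * (u - s) * (u - t) := by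
  simp [cubicOfRoots]

/-- Source identity: the cut sum of the weights `sourceWeight a c (z i - z j)` is invariant
under reversal of the sign of all the `z i`. -/
theorem cutSum_sourceWeight_comm (a c : ℂ) (z : ι → ℂ) (s : Finset ι) :
    ∀ (_ : ∀ i ∈ s, ∀ j ∈ s, i ≠ j → z i ≠ z j)
      (_ : ∀ i ∈ s, ∀ j ∈ s, z i - z j ≠ c ∧ z i - z j ≠ 2 * c) (g : ℕ → ℂ),
    cutSum g (fun i j => sourceWeight a c (z i - z j)) s =
      cutSum g (fun i j => sourceWeight a c (z j - z i)) s := by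
  induction s using Finset.strongInduction with
  | H s ih =>
  intro hz hc g
  obtain rfl | ⟨p, hp⟩ := s.eq_empty_or_nonempty
  · simp [cutSum, cutWeight]
  obtain ⟨t, hpt, rfl⟩ : ∃ t, p ∉ t ∧ insert p t = s := ⟨s.erase p, by simp, insert_erase hp⟩
  have hc0 : c ≠ 0 := fun h => (hc p hp p hp).1 (by simp [h])
  have hz' : ∀ {i j}, i ∈ insert p t → j ∈ insert p t → i ≠ j → z i - z j ≠ 0 :=
    fun hi hj h => sub_ne_zero.2 (hz _ hi _ hj h)
  have hm : ∀ {i j}, i ∈ insert p t → j ∈ insert p t → z i - z j - c ≠ 0 :=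
    fun hi hj => sub_ne_zero.2 (hc _ hi _ hj).1
  have hP : ∀ {i j}, i ∈ insert p t → j ∈ insert p t → z i - z j + c ≠ 0 :=
    fun {i j} hi hj h => (hc j hj i hi).1 (by linear_combination -h)
  have hsub : ∀ {i}, i ∈ t → i ∈ insert p t := fun h => mem_insert_of_mem h
  have ih' : ∀ r, r ⊆ t → ∀ g, cutSum g (fun i j => sourceWeight a c (z i - z j)) r =
      cutSum g (fun i j => sourceWeight a c (z j - z i)) r := by
    intro r hr g
    refine ih r (hr.trans_ssubset (ssubset_insert hpt)) ?_ ?_ g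
    · exact fun i hi j hj => hz i (hsub (hr hi)) j (hsub (hr hj))
    · exact fun i hi j hj => hc i (hsub (hr hi)) j (hsub (hr hj))
  set f : ι → ι → ℂ := fun i j => sourceWeight a c (z i - z j) with hf
  set f' : ι → ι → ℂ := fun i j => sourceWeight a c (z j - z i) with hf'
  -- The weights of `u - z j` and `z j - u` have poles at `z j`, `z j + c` and `z j`, `z j - c`. The
  -- third factor of `A` and `B` brings both to the common denominator `Q`.
  let A : ι → ℂ[X] := fun j => cubicOfRoots (z j + a) (z j - a + c) (z j - c)
  let B : ι → ℂ[X] := fun j => cubicOfRoots (z j - a) (z j + a - c) (z j + c)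
  let Q : ι → ℂ[X] := fun j => cubicOfRoots (z j) (z j + c) (z j - c)
  let P : ℂ[X] := clearedCutSum g f t A B Q - clearedCutSum g f' t B A Q
  have hA : ∀ u j, (A j).eval u = (u - (z j + a)) * (u - (z j - a + c)) * (u - (z j - c)) :=
    fun u j => eval_cubicOfRoots _ _ _ _
  have hB : ∀ u j, (B j).eval u = (u - (z j - a)) * (u - (z j + a - c)) * (u - (z j + c)) :=
    fun u j => eval_cubicOfRoots _ _ _ _
  have hQ : ∀ u j, (Q j).eval u = (u - z j) * (u - (z j + c)) * (u - (z j - c)) :=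
    fun u j => eval_cubicOfRoots _ _ _ _
  have cubic : ∀ w : ℂ, w ≠ 0 → w - c ≠ 0 →
      (w - a) * (w + a - c) * (w + c) = sourceWeight a c w * (w * (w - c) * (w + c)) := by
    intro w h1 h2
    rw [sourceWeight]; field_simp
  have evalA : ∀ u j, u - z j ≠ 0 → u - z j - c ≠ 0 →
      (A j).eval u = sourceWeight a c (u - z j) * (Q j).eval u := by
    intro u j h1 h2
    rw [hA, hQ]
    linear_combination cubic (u - z j) h1 h2
  have evalB : ∀ u j, u - z j ≠ 0 → u - z j + c ≠ 0 →
      (B j).eval u = sourceWeight a c (z j - u) * (Q j).eval u := by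
    intro u j h1 h2
    rw [hB, hQ]
    linear_combination - cubic (z j - u) (fun h => h1 (by linear_combination -h))
      (fun h => h2 (by linear_combination -h))
  -- At `u = z q ± c` this symmetry turns the factors into weights between `q` and `j`, so both sums
  -- get the same prefactor and the induction hypothesis applies to the points other than `q`.
  have sym : ∀ w, sourceWeight a c (w + c) = sourceWeight a c (-w) := by
    intro w
    rw [sourceWeight, sourceWeight]
    congr 1 <;> ring
  -- The coefficients of degree `3 * #t` agree by the induction hypothesis for `t`.
  have hdeg : P.degree < (#(t ×ˢ (univ : Finset (Fin 3))) : ℕ) := by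
    rw [degree_lt_iff_coeff_zero]
    intro m hm
    rw [card_product, card_univ, Fintype.card_fin] at hm
    rw [coeff_sub, coeff_clearedCutSum g f t A B Q (fun j => monic_cubicOfRoots _ _ _)
      (fun j => monic_cubicOfRoots _ _ _) (fun j => monic_cubicOfRoots _ _ _) hm,
      coeff_clearedCutSum g f' t B A Q (fun j => monic_cubicOfRoots _ _ _)
      (fun j => monic_cubicOfRoots _ _ _) (fun j => monic_cubicOfRoots _ _ _) hm,
      ih' t Subset.rfl, ih' t Subset.rfl, sub_self]
  have hroot0 : ∀ q ∈ t, P.eval (z q) = 0 := by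
    intro q hq
    obtain ⟨r, hqr, rfl⟩ : ∃ r, q ∉ r ∧ insert q r = t := ⟨t.erase q, by simp, insert_erase hq⟩
    have hne : ∀ j ∈ r, q ≠ j := by rintro j hj rfl; exact hqr hj
    have h1 : ∀ j ∈ r, z q - z j ≠ 0 :=
      fun j hj => hz' (hsub hq) (hsub (mem_insert_of_mem hj)) (hne j hj)
    have h2 : ∀ j ∈ r, z q - z j - c ≠ 0 :=
      fun j hj => hm (hsub hq) (hsub (mem_insert_of_mem hj))
    have h3 : ∀ j ∈ r, z q - z j + c ≠ 0 :=
      fun j hj => hP (hsub hq) (hsub (mem_insert_of_mem hj))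
    have h4 : (Q q).eval (z q) = 0 := by rw [hQ]; ring
    have h5 : (A q).eval (z q) = -(B q).eval (z q) := by rw [hA, hB]; ring
    rw [eval_sub, eval_clearedCutSum, eval_clearedCutSum,
      clearedCutSum_insert_eq_zero g f hqr _ _ _ h4 h5
        (fun j hj => evalA _ j (h1 j hj) (h2 j hj)) (fun j hj => evalB _ j (h1 j hj) (h3 j hj)),
      clearedCutSum_insert_eq_zero g f' hqr _ _ _ h4 (by rw [h5, neg_neg])
        (fun j hj => evalB _ j (h1 j hj) (h3 j hj)) (fun j hj => evalA _ j (h1 j hj) (h2 j hj)),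
      sub_zero]
  have hroot1 : ∀ q ∈ t, P.eval (z q + c) = 0 := by
    intro q hq
    obtain ⟨r, hqr, rfl⟩ : ∃ r, q ∉ r ∧ insert q r = t := ⟨t.erase q, by simp, insert_erase hq⟩
    have hne : ∀ j ∈ r, q ≠ j := by rintro j hj rfl; exact hqr hj
    have h1 : ∀ j ∈ r, (A j).eval (z q + c) =
        sourceWeight a c (z j - z q) * (Q j).eval (z q + c) := by
      intro j hj
      rw [evalA, show z q + c - z j = z q - z j + c by ring, sym, neg_sub]
      · rw [show z q + c - z j = z q - z j + c by ring]
        exact hP (hsub hq) (hsub (mem_insert_of_mem hj))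
      · rw [show z q + c - z j - c = z q - z j by ring]
        exact hz' (hsub hq) (hsub (mem_insert_of_mem hj)) (hne j hj)
    have h4 : (Q q).eval (z q + c) = 0 := by rw [hQ]; ring
    have h5 : (B q).eval (z q + c) = 0 := by rw [hB]; ring
    rw [eval_sub, eval_clearedCutSum, eval_clearedCutSum,
      clearedCutSum_insert_of_right g f hqr _ _ _ h4 h5 h1,
      clearedCutSum_insert_of_left g f' hqr _ _ _ h4 h5 h1, ih' r (subset_insert _ _), sub_self]
  have hroot2 : ∀ q ∈ t, P.eval (z q - c) = 0 := by
    intro q hq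
    obtain ⟨r, hqr, rfl⟩ : ∃ r, q ∉ r ∧ insert q r = t := ⟨t.erase q, by simp, insert_erase hq⟩
    have hne : ∀ j ∈ r, q ≠ j := by rintro j hj rfl; exact hqr hj
    have h1 : ∀ j ∈ r, (B j).eval (z q - c) =
        sourceWeight a c (z q - z j) * (Q j).eval (z q - c) := by
      intro j hj
      rw [evalB, show z j - (z q - c) = z j - z q + c by ring, sym, neg_sub]
      · rw [show z q - c - z j = z q - z j - c by ring]
        exact hm (hsub hq) (hsub (mem_insert_of_mem hj))
      · rw [show z q - c - z j + c = z q - z j by ring]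
        exact hz' (hsub hq) (hsub (mem_insert_of_mem hj)) (hne j hj)
    have h4 : (Q q).eval (z q - c) = 0 := by rw [hQ]; ring
    have h5 : (A q).eval (z q - c) = 0 := by rw [hA]; ring
    rw [eval_sub, eval_clearedCutSum, eval_clearedCutSum,
      clearedCutSum_insert_of_left g f hqr _ _ _ h4 h5 h1,
      clearedCutSum_insert_of_right g f' hqr _ _ _ h4 h5 h1, ih' r (subset_insert _ _), sub_self]
  -- The nodes `z q`, `z q + c`, `z q - c` are `3 * #t` distinct points: a coincidence would force a
  -- difference of the `z`'s to be `0`, `±c` or `±2c`.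
  have hP0 : P = 0 := by
    refine eq_zero_of_degree_lt_of_eval_index_eq_zero
      (v := fun x : ι × Fin 3 => z x.1 + ![0, c, -c] x.2) (s := t ×ˢ univ) ?_ hdeg ?_
    · rintro ⟨i, e⟩ hi ⟨j, e'⟩ hj h
      have hi' : i ∈ insert p t := hsub (by simpa using hi)
      have hj' : j ∈ insert p t := hsub (by simpa using hj)
      have hij := hc i hi' j hj'
      have hji := hc j hj' i hi'
      have hee : e = e' := by
        by_contra hne
        fin_cases e <;> fin_cases e' <;> simp at h hne <;> first
          | exact hij.1 (by linear_combination h)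
          | exact hij.2 (by linear_combination h)
          | exact hji.1 (by linear_combination -h)
          | exact hji.2 (by linear_combination -h)
      subst hee
      have : i = j := by
        by_contra hne
        exact hz i hi' j hj' hne (by simpa using h)
      rw [this]
    · rintro ⟨q, e⟩ hq
      have hqt : q ∈ t := by simpa using hq
      fin_cases e
      · simpa using hroot0 q hqt
      · simpa using hroot1 q hqt
      · simpa [← sub_eq_add_neg] using hroot2 q hqt
  have hne : ∀ j ∈ t, p ≠ j := by rintro j hj rfl; exact hpt hj
  have hev : P.eval (z p) = 0 := by rw [hP0, eval_zero]
  have h1 : ∀ j ∈ t, z p - z j ≠ 0 := fun j hj => hz' hp (hsub hj) (hne j hj)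
  have hA1 : ∀ j ∈ t, (A j).eval (z p) = f p j * (Q j).eval (z p) :=
    fun j hj => evalA _ j (h1 j hj) (hm hp (hsub hj))
  have hB1 : ∀ j ∈ t, (B j).eval (z p) = f j p * (Q j).eval (z p) :=
    fun j hj => evalB _ j (h1 j hj) (hP hp (hsub hj))
  have hQ1 : ∏ j ∈ t, (Q j).eval (z p) ≠ 0 := by
    refine prod_ne_zero_iff.2 fun j hj => ?_
    rw [hQ, ← sub_sub, show z p - (z j - c) = z p - z j + c by ring]
    exact mul_ne_zero (mul_ne_zero (h1 j hj) (hm hp (hsub hj))) (hP hp (hsub hj))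
  rw [eval_sub, eval_clearedCutSum, eval_clearedCutSum,
    clearedCutSum_eq g f hpt _ _ _ hA1 hB1, clearedCutSum_eq g f' hpt _ _ _ hB1 hA1,
    ← mul_sub] at hev
  exact sub_eq_zero.1 ((mul_eq_zero.1 hev).resolve_left hQ1)

end SourceIdentity

/-! ### Specialisation to strings of points with step one -/

section Strings

variable {n : ℕ}

/-- The left-hand side of the duality; the right-hand side is obtained from it by the
substitution `(x, y) ↦ (-y, -x)`. -/
noncomputable def dualitySum (α : ℂ) (x y : Fin n → ℂ) (K : ℕ) : ℂ :=
  ∑ k ∈ tuples n K,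
    (∏ i, poch (1 + α) (k i) / ((k i).factorial : ℂ)) *
    (∏ i, ∏ j with i ≠ j,
      poch (x i - x j - k j - α) (k i) / poch (x i - x j - k j) (k i)) *
    (∏ a, ∏ j, poch (x j - y a + α) (k j) / poch (x j - y a) (k j))

/-- No integer translate of a difference of coordinates of `x` is `α`, `2 * α` or, except for
trivial reasons, zero. -/
def IsGenericFor (α : ℂ) (x : Fin n → ℂ) : Prop :=
  ∀ i j (d : ℤ), (x i - x j + d = 0 → i = j ∧ d = 0) ∧ x i - x j + d ≠ α ∧ x i - x j + d ≠ 2 * α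

/-- The index set of strings of lengths `m j`. -/
def strings (m : Fin n → ℕ) : Finset (Σ _ : Fin n, ℕ) := univ.sigma fun j => range (m j)

/-- The point with index `⟨j, s⟩` of the strings starting at the points `x j`. -/
noncomputable def stringPoint (x : Fin n → ℂ) (p : Σ _ : Fin n, ℕ) : ℂ := x p.1 + p.2

theorem Finset.eq_range_card_of_forall_succ_mem {T : Finset ℕ} (h : ∀ s, s + 1 ∈ T → s ∈ T) :
    T = range #T := by
  obtain ⟨b, hb⟩ : ∃ b, b ∉ T := Infinite.exists_notMem_finset T
  have hex : ∃ b, b ∉ T := ⟨b, hb⟩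
  have hup : ∀ d, Nat.find hex + d ∉ T := by
    intro d
    induction d with
    | zero => exact Nat.find_spec hex
    | succ d ih => exact fun h' => ih (h _ h')
  have hT : T = range (Nat.find hex) := by
    ext s
    rw [mem_range]
    constructor
    · intro hs
      by_contra hlt
      obtain ⟨d, rfl⟩ := Nat.exists_eq_add_of_le (not_lt.1 hlt)
      exact hup d hs
    · intro hs
      by_contra hmem
      exact Nat.find_min hex hs hmem
  rw [hT, card_range]

/-- The factor at `u` is `(w - u - 1) / (w - u)` times `(w - u - α) / (w - u - 1 - α)`, and both
telescope. Nonvanishing of `w - u` is asked only for `u ≥ k`, because inside a single string `w` is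
a natural number below `k`. -/
theorem prod_Ico_sourceWeight (α w : ℂ) {k m : ℕ} (hkm : k ≤ m)
    (hw : ∀ u : ℕ, k ≤ u → w - u ≠ 0) (hα : ∀ u : ℕ, w - u - α ≠ 0) :
    ∏ u ∈ Ico k m, sourceWeight 1 (1 + α) (w - u) =
      (w - m) * (w - k - α) / ((w - k) * (w - m - α)) := by
  induction m, hkm using Nat.le_induction with
  | base => rw [Ico_self, prod_empty, div_self (mul_ne_zero (hw k le_rfl) (hα k))]
  | succ m hkm ih =>
    have h1 := hw k le_rfl
    have h2 := hw m hkm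
    have h3 := hα m
    have h4 := hα (m + 1)
    rw [prod_Ico_succ_top hkm, ih, sourceWeight,
      show w - m - (1 + α) = w - (m + 1 : ℕ) - α by push_cast; ring,
      show w - m + 1 - (1 + α) = w - m - α by ring,
      show w - m - 1 = w - (m + 1 : ℕ) by push_cast; ring]
    field_simp

theorem poch_neg_sub_div_poch_neg (α : ℂ) (k : ℕ) :
    poch (-k - α) k / poch (-k) k = poch (1 + α) k / (k.factorial : ℂ) := by
  have h : ∀ β : ℂ, poch (-k - β) k = (-1) ^ k * poch (1 + β) k := by
    intro β
    rw [poch_eq_prod, poch_eq_prod, ← prod_range_reflect, ← card_range k, ← prod_const,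
      card_range, ← prod_mul_distrib]
    refine prod_congr rfl fun s hs => ?_
    rw [mem_range] at hs
    rw [Nat.cast_sub (by omega), Nat.cast_sub (by omega)]
    push_cast; ring
  have h0 : poch (-k) k = (-1) ^ k * (k.factorial : ℂ) := by
    have := h 0
    rw [sub_zero, add_zero] at this
    rw [this, poch, ascPochhammer_eval_one]
  rw [h α, h0, mul_div_mul_left _ _ (pow_ne_zero _ (by norm_num))]

/-- For each pair of strings the product telescopes: the lower end `k j` gives the factor in `x i -
x j`, the upper end `m j` the factor in `x i - y j` with `y j = x j + m j + α`. -/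
theorem cutWeight_sigma_range (α : ℂ) (x : Fin n → ℂ) (hx : IsGenericFor α x)
    (m k : Fin n → ℕ) (hkm : k ≤ m) :
    cutWeight (fun p q => sourceWeight 1 (1 + α) (stringPoint x p - stringPoint x q)) (strings m)
      (strings k) =
    (∏ i, poch (1 + α) (k i) / ((k i).factorial : ℂ)) *
    (∏ i, ∏ j with i ≠ j,
      poch (x i - x j - k j - α) (k i) / poch (x i - x j - k j) (k i)) *
    (∏ a, ∏ j, poch (x j - (x a + m a + α) + α) (k j) / poch (x j - (x a + m a + α)) (k j)) := by
  have hsdiff : strings m \ strings k = univ.sigma fun j => Ico (k j) (m j) := by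
    ext ⟨j, s⟩
    simp [strings, and_comm]
  have hpair : ∀ i j, ∏ s ∈ range (k i), ∏ u ∈ Ico (k j) (m j),
      sourceWeight 1 (1 + α) (x i + s - (x j + u)) =
      poch (x i - x j - k j - α) (k i) / poch (x i - x j - k j) (k i) *
      (poch (x i - (x j + m j + α) + α) (k i) / poch (x i - (x j + m j + α)) (k i)) := by
    intro i j
    simp only [poch_eq_prod, ← prod_div_distrib, ← prod_mul_distrib]
    refine prod_congr rfl fun s hs => ?_
    rw [mem_range] at hs
    have := prod_Ico_sourceWeight α (x i - x j + s) (hkm j) (fun u hu h => ?_) (fun u h => ?_)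
    · refine (prod_congr rfl fun u _ => ?_).trans (this.trans ?_)
      · congr 1; ring
      · rw [div_mul_div_comm]; congr 1 <;> ring
    · obtain ⟨rfl, hd⟩ := (hx i j ((s : ℤ) - u)).1 (by push_cast; linear_combination h)
      omega
    · exact (hx i j ((s : ℤ) - u)).2.1 (by push_cast; linear_combination h)
  -- The factor `(1 + α)_k / k!` is the missing diagonal term `j = i`.
  have hdiag : ∀ i, poch (1 + α) (k i) / ((k i).factorial : ℂ) *
      ∏ j with i ≠ j, poch (x i - x j - k j - α) (k i) / poch (x i - x j - k j) (k i) =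
      ∏ j, poch (x i - x j - k j - α) (k i) / poch (x i - x j - k j) (k i) := by
    intro i
    rw [filter_ne, ← mul_prod_erase univ _ (mem_univ i), sub_self, zero_sub,
      poch_neg_sub_div_poch_neg]
  rw [← prod_mul_distrib, prod_congr rfl fun i _ => hdiag i,
    prod_comm (f := fun a j => poch (x j - (x a + m a + α) + α) (k j) / _), ← prod_mul_distrib,
    cutWeight, hsdiff, strings, prod_sigma]
  refine prod_congr rfl fun i _ => ?_
  simp only [prod_sigma]
  rw [prod_comm, ← prod_mul_distrib]
  exact prod_congr rfl fun j _ => hpair i j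

theorem cutSum_strings (α : ℂ) (x : Fin n → ℂ) (hx : IsGenericFor α x) (K : ℕ)
    (m : Fin n → ℕ) (hm : ∀ j, K ≤ m j) :
    cutSum (fun r => if r = K then 1 else 0)
      (fun p q => sourceWeight 1 (1 + α) (stringPoint x p - stringPoint x q)) (strings m) =
      dualitySum α x (fun j => x j + m j + α) K := by
  have hcard : ∀ k : Fin n → ℕ, #(strings k) = ∑ i, k i := by
    intro k; simp [strings, card_sigma]
  have hkm : ∀ k ∈ tuples n K, k ≤ m := by
    intro k hk j
    rw [mem_tuples] at hk
    exact (single_le_sum (fun _ _ => Nat.zero_le _) (mem_univ j)).trans (hk.le.trans (hm j))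
  rw [cutSum, dualitySum]
  symm
  refine sum_of_injOn strings ?_ ?_ ?_ ?_
  · intro k _ l _ hkl
    ext j
    have : ∀ s, s < k j ↔ s < l j := fun s => by
      simpa [strings] using congrArg (fun T => (⟨j, s⟩ : Σ _ : Fin n, ℕ) ∈ T) hkl
    exact le_antisymm (not_lt.1 fun h => lt_irrefl _ ((this _).1 h))
      (not_lt.1 fun h => lt_irrefl _ ((this _).2 h))
  · intro k hk
    simp only [coe_powerset, Set.mem_preimage, Set.mem_powerset_iff, coe_subset]
    exact sigma_mono (Subset.refl _) fun j => range_subset_range.2 (hkm k hk j)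
  · intro I hI hnot
    have hI := mem_powerset.1 hI
    by_contra hne
    obtain ⟨hK, hW⟩ := mul_ne_zero_iff.1 hne
    have hK : #I = K := by by_contra h; simp [h] at hK
    -- If `I` contained `s + 1` but not `s` in some string, a weight would be evaluated at
    -- difference `1 = a`, where it vanishes.
    have hdown : ∀ j s, (⟨j, s + 1⟩ : Σ _ : Fin n, ℕ) ∈ I → (⟨j, s⟩ : Σ _ : Fin n, ℕ) ∈ I := by
      intro j s hs
      by_contra hs'
      rw [cutWeight, prod_ne_zero_iff] at hW
      have h1 := hW _ hs
      rw [prod_ne_zero_iff] at h1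
      have h2 : (⟨j, s⟩ : Σ _ : Fin n, ℕ) ∈ strings m := by
        have := hI hs
        simp only [strings, mem_sigma, mem_univ, mem_range, true_and] at this ⊢
        omega
      refine h1 _ (mem_sdiff.2 ⟨h2, hs'⟩) ?_
      simp [sourceWeight, stringPoint]
    let T : Fin n → Finset ℕ := fun j => {s ∈ range (m j) | (⟨j, s⟩ : Σ _ : Fin n, ℕ) ∈ I}
    have hT : ∀ j s, s ∈ T j ↔ (⟨j, s⟩ : Σ _ : Fin n, ℕ) ∈ I := by
      intro j s
      simp only [T, mem_filter, and_iff_right_iff_imp]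
      intro h
      simpa [strings] using hI h
    have hIT : strings (fun j => #(T j)) = I := by
      ext ⟨j, s⟩
      rw [← hT, strings, mem_sigma, ← Finset.eq_range_card_of_forall_succ_mem]
      · simp
      · intro s; rw [hT, hT]; exact hdown j s
    refine hnot ⟨fun j => #(T j), ?_, hIT⟩
    rw [mem_coe, mem_tuples, ← hcard, hIT, hK]
  · intro k hk
    rw [cutWeight_sigma_range α x hx m k (hkm k hk), hcard, (mem_tuples _ _ _).1 hk, if_pos rfl,
      one_mul]

end Strings

/-! ### Reversal of the strings, and the duality at special points -/

section Reflection

theorem cutSum_congr_of_involutive {ι : Type*} [DecidableEq ι] (g : ℕ → ℂ) {f f' : ι → ι → ℂ}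
    {s : Finset ι} (e : ι → ι) (he : Function.Involutive e) (hes : ∀ i ∈ s, e i ∈ s)
    (hf : ∀ i ∈ s, ∀ j ∈ s, f' i j = f (e i) (e j)) : cutSum g f' s = cutSum g f s := by
  have himg : s.image e = s := by
    ext i
    refine ⟨fun h => ?_, fun h => mem_image.2 ⟨e i, hes i h, he i⟩⟩
    obtain ⟨j, hj, rfl⟩ := mem_image.1 h
    exact hes j hj
  have hmaps : ∀ I ∈ s.powerset, I.image e ∈ s.powerset := fun I hI =>
    mem_powerset.2 ((image_subset_image (mem_powerset.1 hI)).trans himg.subset)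
  have hinv : ∀ I : Finset ι, (I.image e).image e = I := fun I => by
    rw [image_image, he.comp_self, image_id]
  refine sum_nbij' (fun I => I.image e) (fun I => I.image e) hmaps hmaps
    (fun I _ => hinv I) (fun I _ => hinv I) fun I hI => ?_
  have hI := mem_powerset.1 hI
  rw [card_image_of_injective _ he.injective, cutWeight, cutWeight,
    prod_image he.injective.injOn]
  congr 1
  refine prod_congr rfl fun i hi => ?_
  conv_rhs => rw [← himg, ← image_sdiff _ _ he.injective, prod_image he.injective.injOn]
  exact prod_congr rfl fun j hj => hf i (hI hi) j (mem_sdiff.1 hj).1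

variable {n : ℕ}

theorem cutSum_strings_neg (α : ℂ) (x : Fin n → ℂ) (g : ℕ → ℂ) (m : Fin n → ℕ) :
    cutSum g (fun p q => sourceWeight 1 (1 + α) (stringPoint x q - stringPoint x p))
      (strings m) =
    cutSum g (fun p q => sourceWeight 1 (1 + α)
      (stringPoint (fun j => -x j - m j + 1) p - stringPoint (fun j => -x j - m j + 1) q))
      (strings m) := by
  symm
  -- Each string is read backwards. Indices outside the strings are fixed, which makes the map an
  -- involution on the whole index type.
  refine cutSum_congr_of_involutive g
    (fun p => ⟨p.1, if p.2 < m p.1 then m p.1 - 1 - p.2 else p.2⟩) ?_ ?_ ?_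
  · rintro ⟨j, s⟩
    simp only [Sigma.mk.injEq, heq_eq_eq, true_and]
    split_ifs <;> omega
  · rintro ⟨j, s⟩ h
    simp only [strings, mem_sigma, mem_univ, mem_range, true_and] at h ⊢
    rw [if_pos h]; omega
  · have key : ∀ (j : Fin n) (s : ℕ), s < m j →
        ((m j - 1 - s : ℕ) : ℂ) = m j - 1 - s := by
      intro j s hs
      rw [Nat.cast_sub (by omega), Nat.cast_sub (by omega), Nat.cast_one]
    rintro ⟨i, s⟩ hi ⟨j, t⟩ hj
    simp only [strings, mem_sigma, mem_univ, mem_range, true_and] at hi hj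
    simp only [stringPoint, if_pos hi, if_pos hj, key _ _ hi, key _ _ hj]
    congr 1; ring

theorem dualitySum_congr (α : ℂ) (K : ℕ) {x y x' y' : Fin n → ℂ}
    (hx : ∀ i j, x i - x j = x' i - x' j) (hxy : ∀ i j, x i - y j = x' i - y' j) :
    dualitySum α x y K = dualitySum α x' y' K := by
  simp only [dualitySum, hx, hxy]

/-- The duality at points where the differences `y j - x j - α` are large integers. -/
theorem dualitySum_eq_of_isGenericFor (α : ℂ) (x : Fin n → ℂ) (hx : IsGenericFor α x) (K : ℕ)
    (m : Fin n → ℕ) (hm : ∀ j, K ≤ m j) :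
    dualitySum α x (fun j => x j + m j + α) K =
      dualitySum α (fun j => -(x j + m j + α)) (fun j => -x j) K := by
  have hα : IsGenericFor α (fun j => -x j - m j + 1) := by
    intro i j d
    have h : -x i - m i + 1 - (-x j - m j + 1) + d = x j - x i + ((m j - m i + d : ℤ) : ℂ) := by
      push_cast; ring
    rw [h]
    refine ⟨fun h0 => ?_, (hx j i _).2⟩
    obtain ⟨rfl, hd⟩ := (hx j i _).1 h0
    exact ⟨rfl, by simpa using hd⟩
  rw [← cutSum_strings α x hx K m hm, cutSum_sourceWeight_comm, cutSum_strings_neg,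
    cutSum_strings α _ hα K m hm]
  -- Both sets of variables are translated by `1 + α`, which leaves all differences unchanged.
  · refine dualitySum_congr α K (fun i j => ?_) (fun i j => ?_) <;> ring
  · rintro ⟨i, s⟩ - ⟨j, t⟩ - hne heq
    simp only [stringPoint] at heq
    obtain ⟨rfl, h⟩ := (hx i j (s - t)).1 (by push_cast; linear_combination heq)
    exact hne (by rw [show s = t by omega])
  · rintro ⟨i, s⟩ - ⟨j, t⟩ -
    simp only [stringPoint]
    constructor
    · intro h
      exact (hx i j (s - t - 1)).2.1 (by push_cast; linear_combination h)
    · intro h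
      exact (hx i j (s - t - 2)).2.2 (by push_cast; linear_combination h)

end Reflection

/-! ### Rational functions determined by their values on an infinite box -/

section Rational

variable {σ : Type*} {D : Set (σ → ℂ)}

/-- The function `f` agrees on `D` with a quotient of polynomials whose denominator does not
vanish on `D`. -/
def IsRationalOn (D : Set (σ → ℂ)) (f : (σ → ℂ) → ℂ) : Prop :=
  ∃ P Q : MvPolynomial σ ℂ, ∀ v ∈ D, MvPolynomial.eval v Q ≠ 0 ∧
    f v * MvPolynomial.eval v Q = MvPolynomial.eval v P

namespace IsRationalOn

theorem const (c : ℂ) : IsRationalOn D fun _ => c :=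
  ⟨MvPolynomial.C c, 1, fun v _ => by simp⟩

theorem coord (i : σ) : IsRationalOn D fun v => v i :=
  ⟨MvPolynomial.X i, 1, fun v _ => by simp⟩

theorem add {f g : (σ → ℂ) → ℂ} (hf : IsRationalOn D f) (hg : IsRationalOn D g) :
    IsRationalOn D fun v => f v + g v := by
  obtain ⟨P, Q, h⟩ := hf
  obtain ⟨P', Q', h'⟩ := hg
  refine ⟨P * Q' + P' * Q, Q * Q', fun v hv => ?_⟩
  obtain ⟨h1, h2⟩ := h v hv
  obtain ⟨h3, h4⟩ := h' v hv
  simp only [map_mul, map_add]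
  exact ⟨mul_ne_zero h1 h3, by rw [← h2, ← h4]; ring⟩

theorem mul {f g : (σ → ℂ) → ℂ} (hf : IsRationalOn D f) (hg : IsRationalOn D g) :
    IsRationalOn D fun v => f v * g v := by
  obtain ⟨P, Q, h⟩ := hf
  obtain ⟨P', Q', h'⟩ := hg
  refine ⟨P * P', Q * Q', fun v hv => ?_⟩
  obtain ⟨h1, h2⟩ := h v hv
  obtain ⟨h3, h4⟩ := h' v hv
  simp only [map_mul]
  exact ⟨mul_ne_zero h1 h3, by rw [← h2, ← h4]; ring⟩

theorem div {f g : (σ → ℂ) → ℂ} (hf : IsRationalOn D f) (hg : IsRationalOn D g)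
    (h0 : ∀ v ∈ D, g v ≠ 0) : IsRationalOn D fun v => f v / g v := by
  obtain ⟨P, Q, h⟩ := hf
  obtain ⟨P', Q', h'⟩ := hg
  refine ⟨P * Q', Q * P', fun v hv => ?_⟩
  obtain ⟨h1, h2⟩ := h v hv
  obtain ⟨h3, h4⟩ := h' v hv
  have h5 := h0 v hv
  simp only [map_mul]
  refine ⟨mul_ne_zero h1 (h4 ▸ mul_ne_zero h5 h3), ?_⟩
  rw [← h2, ← h4]; field_simp

theorem neg {f : (σ → ℂ) → ℂ} (hf : IsRationalOn D f) : IsRationalOn D fun v => -f v := by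
  simpa using (const (-1)).mul hf

theorem sub {f g : (σ → ℂ) → ℂ} (hf : IsRationalOn D f) (hg : IsRationalOn D g) :
    IsRationalOn D fun v => f v - g v := by
  simpa [sub_eq_add_neg] using hf.add hg.neg

theorem sum {κ : Type*} {s : Finset κ} {f : κ → (σ → ℂ) → ℂ}
    (hf : ∀ i ∈ s, IsRationalOn D (f i)) : IsRationalOn D fun v => ∑ i ∈ s, f i v := by
  classical
  induction s using Finset.induction_on with
  | empty => simpa using const 0
  | insert i s hi ih =>
    simp only [sum_insert hi]
    exact (hf i (mem_insert_self _ _)).add (ih fun j hj => hf j (mem_insert_of_mem hj))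

theorem prod {κ : Type*} {s : Finset κ} {f : κ → (σ → ℂ) → ℂ}
    (hf : ∀ i ∈ s, IsRationalOn D (f i)) : IsRationalOn D fun v => ∏ i ∈ s, f i v := by
  classical
  induction s using Finset.induction_on with
  | empty => simpa using const 1
  | insert i s hi ih =>
    simp only [prod_insert hi]
    exact (hf i (mem_insert_self _ _)).mul (ih fun j hj => hf j (mem_insert_of_mem hj))

theorem poch {f : (σ → ℂ) → ℂ} (hf : IsRationalOn D f) (k : ℕ) :
    IsRationalOn D fun v => poch (f v) k := by
  simp only [poch_eq_prod]
  exact prod fun m _ => hf.add (const m)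

/-- Two rational functions which agree on a box with infinite sides agree everywhere. -/
theorem eq_of_eqOn_pi {f g : (σ → ℂ) → ℂ} (hf : IsRationalOn D f) (hg : IsRationalOn D g)
    (S : σ → Set ℂ) (hS : ∀ i, (S i).Infinite) (hSD : Set.pi .univ S ⊆ D)
    (h : ∀ v ∈ Set.pi .univ S, f v = g v) {v : σ → ℂ} (hv : v ∈ D) : f v = g v := by
  obtain ⟨P, Q, hPQ⟩ := hf.sub hg
  have hP : P = 0 := MvPolynomial.funext_set S hS fun w hw => by
    simp [← (hPQ w (hSD hw)).2, h w hw]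
  obtain ⟨h1, h2⟩ := hPQ v hv
  rw [hP, map_zero] at h2
  exact sub_eq_zero.1 ((mul_eq_zero.1 h2).resolve_right h1)

end IsRationalOn

theorem isRationalOn_dualitySum {n K : ℕ} {α : (σ → ℂ) → ℂ} {x y : (σ → ℂ) → Fin n → ℂ}
    (hα : IsRationalOn D α) (hx : ∀ j, IsRationalOn D fun v => x v j)
    (hy : ∀ j, IsRationalOn D fun v => y v j)
    (hxx : ∀ v ∈ D, ∀ k ∈ tuples n K, ∀ i j : Fin n, i ≠ j →
      poch (x v i - x v j - k j) (k i) ≠ 0)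
    (hxy : ∀ v ∈ D, ∀ k ∈ tuples n K, ∀ j a : Fin n, poch (x v j - y v a) (k j) ≠ 0) :
    IsRationalOn D fun v => dualitySum (α v) (x v) (y v) K := by
  refine .sum fun k hk => .mul (.mul (.prod fun i _ => ?_) (.prod fun i _ => .prod fun j hj => ?_))
    (.prod fun a _ => .prod fun j _ => ?_)
  · exact (((IsRationalOn.const 1).add hα).poch _).div (.const _)
      fun _ _ => Nat.cast_ne_zero.2 (Nat.factorial_ne_zero _)
  · have h := ((hx i).sub (hx j)).sub (.const (k j : ℂ))
    exact ((h.sub hα).poch _).div (h.poch _)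
      fun v hv => hxx v hv k hk i j (mem_filter.1 hj).2
  · have h := (hx j).sub (hy a)
    exact ((h.add hα).poch _).div (h.poch _) fun v hv => hxy v hv k hk j a

end Rational

/-! ### Extension from special points to all admissible parameters -/

section Duality

variable {n : ℕ}

theorem infinite_setOf_natCast_add (K : ℕ) (c : ℂ) :
    {w : ℂ | ∃ m : ℕ, K ≤ m ∧ w = m + c}.Infinite := by
  refine (Set.infinite_range_of_injective (f := fun m : ℕ => ((m + K : ℕ) : ℂ) + c) ?_).mono ?_
  · intro a b h
    simpa using h
  · rintro _ ⟨m, rfl⟩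
    exact ⟨m + K, by omega, rfl⟩

/-- If the `x j` and `α` lie on distinct horizontal lines of suitable heights, then `α` and `x`
are generic. -/
theorem isGenericFor_of_im {α : ℂ} {x : Fin n → ℂ} (hx : ∀ j, (x j).im = (j : ℕ))
    (hα : α.im = n) : IsGenericFor α x := by
  intro i j d
  have him : (x i - x j + d).im = (i : ℕ) - (j : ℕ) := by simp [hx]
  have hi : ((i : ℕ) : ℝ) < n := Nat.cast_lt.2 i.2
  have hj : (0 : ℝ) ≤ (j : ℕ) := Nat.cast_nonneg _
  refine ⟨fun h => ?_, fun h => ?_, fun h => ?_⟩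
  · rw [h, Complex.zero_im] at him
    obtain rfl : i = j := Fin.ext (Nat.cast_injective (R := ℝ) (by linarith))
    exact ⟨rfl, by simpa using h⟩
  · rw [h, hα] at him
    linarith
  · rw [h] at him
    simp [hα] at him
    linarith

theorem poch_ne_zero_of_forall {w : ℂ} {k : ℕ} (h : ∀ s : ℕ, w + s ≠ 0) : poch w k ≠ 0 := by
  rw [poch_eq_prod]
  exact prod_ne_zero_iff.2 fun s _ => h s

theorem dualitySum_neg_eq (K : ℕ) (α : ℂ) (x y : Fin n → ℂ) :
    dualitySum α (fun j => -y j) (fun j => -x j) K = ∑ k ∈ tuples n K,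
      (∏ a, poch (1 + α) (k a) / ((k a).factorial : ℂ)) *
      (∏ a, ∏ b with a ≠ b,
        poch (y a - y b - k a - α) (k b) / poch (y a - y b - k a) (k b)) *
      (∏ j, ∏ a, poch (x j - y a + α) (k a) / poch (x j - y a) (k a)) := by
  refine sum_congr rfl fun k _ => ?_
  have h : ∀ u v : ℂ, -u - -v = v - u := fun u v => by ring
  simp only [h, prod_filter]
  congr 2
  rw [prod_comm]
  simp only [ne_comm]

/-- The duality transformation between the variables `x` and `y`. -/
theorem dualitySum_eq (K : ℕ) (α : ℂ) (x y : Fin n → ℂ)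
    (hx : ∀ k ∈ tuples n K, ∀ i j : Fin n, i ≠ j → poch (x i - x j - k j) (k i) ≠ 0)
    (hy : ∀ k ∈ tuples n K, ∀ a b : Fin n, a ≠ b → poch (y a - y b - k a) (k b) ≠ 0)
    (hxy : ∀ k ∈ tuples n K, ∀ j a : Fin n,
      poch (x j - y a) (k j) ≠ 0 ∧ poch (x j - y a) (k a) ≠ 0) :
    dualitySum α x y K = dualitySum α (fun j => -y j) (fun j => -x j) K := by
  let A : (Option (Fin n ⊕ Fin n) → ℂ) → ℂ := fun v => v none
  let X : (Option (Fin n ⊕ Fin n) → ℂ) → Fin n → ℂ := fun v j => v (some (.inl j))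
  -- The third group of coordinates is `y j - x j - α`, so that the condition of being an integer `m
  -- j ≥ K` defines a box.
  let Y : (Option (Fin n ⊕ Fin n) → ℂ) → Fin n → ℂ :=
    fun v j => X v j + v (some (.inr j)) + A v
  let D : Set (Option (Fin n ⊕ Fin n) → ℂ) := {v | ∀ k ∈ tuples n K,
    (∀ i j : Fin n, i ≠ j → poch (X v i - X v j - k j) (k i) ≠ 0) ∧
    (∀ a b : Fin n, a ≠ b → poch (Y v a - Y v b - k a) (k b) ≠ 0) ∧
    ∀ j a : Fin n, poch (X v j - Y v a) (k j) ≠ 0 ∧ poch (X v j - Y v a) (k a) ≠ 0}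
  -- Imaginary parts are `n` for `α` and `j` for `x j`. Differences of the `x j` have imaginary part
  -- less than `n` in absolute value, so no integer translate of them can equal `α` or `2 * α`.
  let S : Option (Fin n ⊕ Fin n) → Set ℂ := fun i => {w | ∃ m : ℕ, K ≤ m ∧ w = m +
    (i.elim (n : ℂ) (Sum.elim (fun j => ((j : ℕ) : ℂ)) fun _ => 0)) * Complex.I}
  have hA : IsRationalOn D A := .coord _
  have hX : ∀ j, IsRationalOn D fun v => X v j := fun j => .coord _
  have hY : ∀ j, IsRationalOn D fun v => Y v j := fun j => ((hX j).add (.coord _)).add hA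
  have hgen : ∀ v ∈ Set.pi .univ S, IsGenericFor (A v) (X v) ∧
      ∃ m : Fin n → ℕ, (∀ j, K ≤ m j) ∧ Y v = fun j => X v j + m j + A v := by
    intro v hv
    refine ⟨isGenericFor_of_im (fun j => ?_) ?_, ?_⟩
    · obtain ⟨m, -, hm⟩ := hv (some (.inl j)) trivial
      simp [X, hm]
    · obtain ⟨m, -, hm⟩ := hv none trivial
      simp [A, hm]
    · choose m hm hm' using fun j => hv (some (.inr j)) trivial
      refine ⟨m, hm, funext fun j => ?_⟩
      simp [Y, hm']
  have hSD : Set.pi .univ S ⊆ D := by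
    intro v hv
    obtain ⟨hg, m, -, hm⟩ := hgen v hv
    have hXY : ∀ (j a : Fin n) (k : ℕ), poch (X v j - Y v a) k ≠ 0 := by
      intro j a k
      refine poch_ne_zero_of_forall fun s h => (hg j a (s - m a)).2.1 ?_
      rw [hm] at h
      push_cast; linear_combination h
    refine fun k _ => ⟨fun i j hij => ?_, fun a b hab => ?_, fun j a => ⟨hXY _ _ _, hXY _ _ _⟩⟩
    · refine poch_ne_zero_of_forall fun s h => hij ((hg i j (s - k j)).1 ?_).1
      push_cast; linear_combination h
    · refine poch_ne_zero_of_forall fun s h => hab ((hg a b (m a - m b - k a + s)).1 ?_).1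
      rw [hm] at h
      push_cast; linear_combination h
  let v₀ : Option (Fin n ⊕ Fin n) → ℂ :=
    fun i => i.elim α (Sum.elim x fun j => y j - x j - α)
  have hX₀ : X v₀ = x := rfl
  have hY₀ : Y v₀ = y := by
    funext j
    simp only [Y, X, A, v₀, Option.elim, Sum.elim_inl, Sum.elim_inr]
    ring
  have hv₀ : v₀ ∈ D := by
    intro k hk
    rw [hX₀, hY₀]
    exact ⟨hx k hk, hy k hk, hxy k hk⟩
  have hneg : ∀ u w : ℂ, -u - -w = w - u := fun u w => by ring
  have key := IsRationalOn.eq_of_eqOn_pi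
    (isRationalOn_dualitySum (K := K) hA hX hY (fun v hv k hk => (hv k hk).1)
      fun v hv k hk j a => ((hv k hk).2.2 j a).1)
    (isRationalOn_dualitySum (K := K) (x := fun v j => -Y v j) (y := fun v j => -X v j) hA
      (fun j => (hY j).neg) (fun j => (hX j).neg)
      (fun v hv k hk i j hij => by rw [hneg]; exact (hv k hk).2.1 j i hij.symm)
      fun v hv k hk j a => by rw [hneg]; exact ((hv k hk).2.2 a j).2)
    S (fun i => infinite_setOf_natCast_add _ _) hSD
    (fun v hv => by
      obtain ⟨hg, m, hK, hm⟩ := hgen v hv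
      rw [hm]
      exact dualitySum_eq_of_isGenericFor (A v) (X v) hg K m hK) hv₀
  rwa [hX₀, hY₀] at key

end Duality

theorem mainTheorem2 (n K : ℕ) (α : ℂ) (x y : Fin n → ℂ)
    (hx : ∀ k ∈ tuples n K, ∀ i j : Fin n, i ≠ j → poch (x i - x j - k j) (k i) ≠ 0)
    (hy : ∀ k ∈ tuples n K, ∀ a b : Fin n, a ≠ b → poch (y a - y b - k a) (k b) ≠ 0)
    (hxy : ∀ k ∈ tuples n K, ∀ j a : Fin n,
      poch (x j - y a) (k j) ≠ 0 ∧ poch (x j - y a) (k a) ≠ 0) :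
    (∑ k ∈ tuples n K,
      (∏ i, poch (1 + α) (k i) / ((k i).factorial : ℂ)) *
      (∏ i, ∏ j with i ≠ j,
        poch (x i - x j - k j - α) (k i) / poch (x i - x j - k j) (k i)) *
      (∏ a, ∏ j, poch (x j - y a + α) (k j) / poch (x j - y a) (k j))) =
    ∑ k ∈ tuples n K,
      (∏ a, poch (1 + α) (k a) / ((k a).factorial : ℂ)) *
      (∏ a, ∏ b with a ≠ b,
        poch (y a - y b - k a - α) (k b) / poch (y a - y b - k a) (k b)) *
      (∏ j, ∏ a, poch (x j - y a + α) (k a) / poch (x j - y a) (k a)) := by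
  rw [← dualitySum_neg_eq]
  exact dualitySum_eq K α x y hx hy hxy
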